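/- Let $G=(V,E)$ be a simple directed graph without loops and without pairs of reverse edges, with $n$ nodes and $m$ edges, with capacities $u:E\to\mathbb{R}_{\ge 0}$ and node budgets $b:V\to\mathbb{R}$. A flow is a function $f:E\to\mathbb{R}$ with $0\le f(e)\le u(e)$ for all $e\in E$ and $b(v)+\sum_{e=(x,v)\in E}f(e)=\sum_{e=(v,w)\in E}f(e)$ for all $v\in V$. For a flow $f$ and costs $c:E\to\mathbb{R}$, the residual network $G_f$ has a forward arc $e$ of cost $c(e)$ and capacity $u(e)-f(e)$ for each $e\in E$ with $f(e)<u(e)$, and a backward arc $e^{-1}$ of cost $-c(e)$ and capacity $f(e)$ for each $e\in E$ with $f(e)>0$. The Minimum-Mean Cycle Canceling (MMCC) algorithm starts with a feasible flow; as long as $G_f$ contains a directed cycle of negative total cost, it performs an iteration, which chooses a directed cycle (with distinct nodes) of minimum mean cost (total cost divided by number of arcs) in $G_f$ and augments $f$ along it by the minimum capacity of its arcs. Let $T(c)\in\{0,1,2,\dots\}\cup\{\infty\}$ be the largest number of iterations that the algorithm can perform for costs $c$, over all feasible starting flows and all choices among cycles of minimum mean cost ($T(c)=0$ if there is no feasible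 flow). Suppose that the edge costs $c(e)$, $e\in E$, are independent random variables, where $c(e)$ has a probability density $g_e:[0,1]\to[0,\phi]$ that is chosen by an adversary together with $G$, $u$ and $b$. **Theorem.** There is a universal constant $K>0$ such that, for every such instance, $T(c)$ is a random variable (it is measurable) and $$\mathbb{E}[T(c)]\le K\, m\, n^2\, \log_2(n)\,\max\{1,\log_2\phi\}.$$ In particular, for $\phi\ge 2$ the expected number of iterations of the MMCC algorithm is $O(mn^2\log(n)\log(\phi))$. -/

import Mathlib

open scoped NNReal ENNReal

namespace MinCostFlow

/-- A minimum-cost flow instance without its costs: a simple directed graph with node set `V` and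
edge set `E` that has no pair of reverse edges (for `e = e'` this also excludes loops), together
with nonnegative edge capacities and real node budgets. -/
structure FlowNetwork (V E : Type*) where
  tail : E → V
  head : E → V
  simple : ∀ e e', tail e = tail e' → head e = head e' → e = e'
  no_reverse : ∀ e e', tail e = head e' → head e ≠ tail e'
  cap : E → ℝ≥0
  budget : V → ℝ

variable {V E : Type*}

namespace FlowNetwork

open scoped Classical in
/-- Feasible flows: capacity constraints and `b(v) + inflow(v) = outflow(v)` at every node. -/
def IsFlow [Fintype E] (N : FlowNetwork V E) (f : E → ℝ) : Prop :=
  (∀ e, 0 ≤ f e ∧ f e ≤ N.cap e) ∧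
  ∀ v, N.budget v + ∑ e with N.head e = v, f e = ∑ e with N.tail e = v, f e

/- A residual arc is an element of `E ⊕ E`: `Sum.inl e` is the edge `e` used forward, and
`Sum.inr e` is its reversal. -/

def arcTail (N : FlowNetwork V E) : E ⊕ E → V := Sum.elim N.tail N.head

def arcHead (N : FlowNetwork V E) : E ⊕ E → V := Sum.elim N.head N.tail

/-- Residual capacity: `u(e) - f(e)` on forward arcs and `f(e)` on backward arcs. An arc belongs to
the residual network of `f` exactly if its residual capacity is positive. -/
def resCap (N : FlowNetwork V E) (f : E → ℝ) : E ⊕ E → ℝ :=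
  Sum.elim (fun e => (N.cap e : ℝ) - f e) f

/-- `C` is the arc set of a directed cycle with pairwise distinct nodes, of length `k + 2`
(indices `i + 1` are taken cyclically in `Fin (k + 2)`). -/
def IsDirectedCycle (N : FlowNetwork V E) (C : Finset (E ⊕ E)) : Prop :=
  ∃ (k : ℕ) (a : Fin (k + 2) → E ⊕ E),
    Function.Injective (fun i => N.arcTail (a i)) ∧
    (∀ i, N.arcHead (a i) = N.arcTail (a (i + 1))) ∧
    (C : Set (E ⊕ E)) = Set.range a

/-- `C` is a directed cycle of the residual network of `f`. -/
def IsResidualCycle (N : FlowNetwork V E) (f : E → ℝ) (C : Finset (E ⊕ E)) : Prop :=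
  N.IsDirectedCycle C ∧ ∀ a ∈ C, 0 < N.resCap f a

end FlowNetwork

/-- Residual cost: `c(e)` on forward arcs and `-c(e)` on backward arcs. -/
def arcCost (c : E → ℝ) : E ⊕ E → ℝ := Sum.elim c (fun e => -c e)

/-- The mean cost `μ(C)`. -/
noncomputable def meanCost (c : E → ℝ) (C : Finset (E ⊕ E)) : ℝ :=
  (∑ a ∈ C, arcCost c a) / (C.card : ℝ)

namespace FlowNetwork

/-- `C` is a cycle of minimum mean cost in the residual network of `f`. -/
def IsMinMeanCycle (N : FlowNetwork V E) (c f : E → ℝ) (C : Finset (E ⊕ E)) : Prop :=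
  N.IsResidualCycle f C ∧ ∀ C', N.IsResidualCycle f C' → meanCost c C ≤ meanCost c C'

open scoped Classical in
/-- The flow obtained from `f` by pushing `δ` units along `C`. -/
noncomputable def augment (f : E → ℝ) (C : Finset (E ⊕ E)) (δ : ℝ) : E → ℝ := fun e =>
  f e + (if Sum.inl e ∈ C then δ else 0) - (if Sum.inr e ∈ C then δ else 0)

/-- One iteration of Minimum-Mean Cycle Canceling: there is a residual cycle of negative cost, and
`f'` arises from `f` by maximally augmenting along some (arbitrarily chosen) residual cycle of
minimum mean cost, i.e. by the least residual capacity of its arcs. -/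
def Step (N : FlowNetwork V E) (c f f' : E → ℝ) : Prop :=
  (∃ C, N.IsResidualCycle f C ∧ ∑ a ∈ C, arcCost c a < 0) ∧
  ∃ C δ, N.IsMinMeanCycle c f C ∧ IsLeast (N.resCap f '' C) δ ∧ f' = augment f C δ

/-- The algorithm can perform at least `k` iterations, starting from some feasible flow. -/
def HasRun [Fintype E] (N : FlowNetwork V E) (c : E → ℝ) (k : ℕ) : Prop :=
  ∃ f : ℕ → E → ℝ, N.IsFlow (f 0) ∧ ∀ i < k, N.Step c (f i) (f (i + 1))

/-- The number of iterations of the algorithm for costs `c`, in the worst case over the feasible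
starting flow and over the choices among several cycles of minimum mean cost
(`⊤` if there are arbitrarily long runs, `0` if there is no feasible flow). -/
noncomputable def iterations [Fintype E] (N : FlowNetwork V E) (c : E → ℝ) : ℝ≥0∞ :=
  ⨆ (k : ℕ) (_ : N.HasRun c k), (k : ℝ≥0∞)

end FlowNetwork

/-- The smoothed input model: the edge costs are independent random variables, and the cost of each
edge `e` has a density `g e : [0, 1] → [0, φ]`. -/
def IsSmoothedCost [Fintype E] {Ω : Type*} [MeasurableSpace Ω] (P : MeasureTheory.Measure Ω)
    (φ : ℝ) (c : E → Ω → ℝ) : Prop :=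
  (∀ e, Measurable (c e)) ∧
  ProbabilityTheory.iIndepFun c P ∧
  ∃ g : E → ℝ → ℝ, ∀ e,
    Measurable (g e) ∧ (∀ x ∈ Set.Icc (0 : ℝ) 1, 0 ≤ g e x ∧ g e x ≤ φ) ∧
    P.map (c e) = (MeasureTheory.volume.restrict (Set.Icc (0 : ℝ) 1)).withDensity
      (fun x => ENNReal.ofReal (g e x))

end MinCostFlow

open scoped NNReal ENNReal

namespace MinCostFlow

open MeasureTheory

variable {V E : Type*}

/-! Let μ < 0 be the mean cost of the cycle being canceled. Potentials (`exists_potential`) give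
reduced costs that are at least μ on every residual arc and leave all cycle costs unchanged.
Canceling a cycle of negative reduced arcs destroys a negative residual arc and creates none. So
within m + 1 iterations a cycle with a nonnegative arc is canceled, and its mean is at least (1 -
1/n) μ. Hence m n iterations at least halve |μ| (`neg_half_pow_le_meanCost`).

Now let f be a nonoptimal flow with μ ≥ -ε, and g an optimal flow. Their difference contains a
residual cycle D of f, of cost at least -nε. Partly undoing D in g gives a flow that is nearly
optimal and differs from g on the edges of D. Either g is at a capacity bound on some edge of D, and
that edge has a near tie, or g can be pushed along D both ways, and D has cost exactly 0
(`IsIteration.exists_zero_cycle_or_nearTie`).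

Zero cost has probability 0. As in the isolation lemma, if all costs but c(e) are fixed, a near tie
at e confines c(e) to an interval of length r = 2nε (`nearTie_fiber_dist`), so it has probability at
most φ r. With ε = 2^(-L), a union bound over the m edges and their two bounds shows that more than
m n L iterations occur with probability at most 4 m n φ 2^(-L). Summing over L gives O(m n log(n
φ)), a factor n better than claimed. -/

lemma arcCost_swap (c : E → ℝ) (a : E ⊕ E) : arcCost c a.swap = -arcCost c a := by
  rcases a with e | e <;> simp [arcCost]

open scoped Classical in
/-- The signed incidence vector of a set of arcs. -/
noncomputable def cycleVec (C : Finset (E ⊕ E)) (e : E) : ℝ :=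
  (if Sum.inl e ∈ C then 1 else 0) - (if Sum.inr e ∈ C then 1 else 0)

lemma sum_arcCost [Fintype E] (c : E → ℝ) (C : Finset (E ⊕ E)) :
    ∑ a ∈ C, arcCost c a = ∑ e, c e * cycleVec C e := by
  classical
  have h : ∑ a ∈ C, arcCost c a = ∑ a, if a ∈ C then arcCost c a else 0 := by
    rw [Finset.sum_ite_mem, Finset.univ_inter]
  rw [h, Fintype.sum_sum_type, ← Finset.sum_add_distrib]
  refine Finset.sum_congr rfl fun e _ => ?_
  simp only [arcCost, cycleVec, Sum.elim_inl, Sum.elim_inr]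
  split_ifs <;> simp

/-! ### Directed cycles and potential differences. -/

namespace FlowNetwork

lemma augment_apply (f : E → ℝ) (C : Finset (E ⊕ E)) (δ : ℝ) (e : E) :
    augment f C δ e = f e + δ * cycleVec C e := by
  simp only [augment, cycleVec]
  split_ifs <;> ring

variable (N : FlowNetwork V E)

lemma tail_ne_head (e : E) : N.tail e ≠ N.head e :=
  fun h => N.no_reverse e e h h.symm

lemma arcTail_ne_arcHead (a : E ⊕ E) : N.arcTail a ≠ N.arcHead a := by
  rcases a with e | e
  · exact N.tail_ne_head e
  · exact (N.tail_ne_head e).symm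

lemma arcCost_tension (π : V → ℝ) (a : E ⊕ E) :
    arcCost (fun e => π (N.head e) - π (N.tail e)) a = π (N.arcHead a) - π (N.arcTail a) := by
  rcases a with e | e <;> simp [arcCost, arcHead, arcTail]

variable {N}

section IsDirectedCycle

variable {C : Finset (E ⊕ E)}

lemma IsDirectedCycle.sum_tension (hC : N.IsDirectedCycle C) (π : V → ℝ) :
    ∑ a ∈ C, (π (N.arcHead a) - π (N.arcTail a)) = 0 := by
  classical
  obtain ⟨k, a, hinj, hnext, hset⟩ := hC
  have ha : Function.Injective a := fun i j h => hinj (by simp [h])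
  have hCa : C = Finset.univ.image a := by
    apply Finset.coe_injective
    simp [hset]
  rw [hCa, Finset.sum_image (fun _ _ _ _ h => ha h), Finset.sum_sub_distrib, sub_eq_zero]
  simp only [hnext]
  exact Equiv.sum_comp (Equiv.addRight (1 : Fin (k + 2))) (fun i => π (N.arcTail (a i)))

lemma IsDirectedCycle.nonempty (hC : N.IsDirectedCycle C) : C.Nonempty := by
  obtain ⟨k, a, -, -, hset⟩ := hC
  refine ⟨a 0, ?_⟩
  rw [← Finset.mem_coe, hset]
  exact Set.mem_range_self 0

lemma IsDirectedCycle.injOn_arcTail (hC : N.IsDirectedCycle C) :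
    Set.InjOn N.arcTail (C : Set (E ⊕ E)) := by
  obtain ⟨k, a, hinj, -, hset⟩ := hC
  rw [hset]
  rintro _ ⟨i, rfl⟩ _ ⟨j, rfl⟩ h
  rw [hinj h]

lemma IsDirectedCycle.card_le [Fintype V] (hC : N.IsDirectedCycle C) :
    C.card ≤ Fintype.card V := by
  classical
  rw [← Finset.card_image_of_injOn hC.injOn_arcTail]
  exact Finset.card_le_univ _

lemma IsDirectedCycle.card_pos (hC : N.IsDirectedCycle C) : (0 : ℝ) < C.card := by
  exact_mod_cast hC.nonempty.card_pos

lemma IsDirectedCycle.sum_arcCost_reduced (hC : N.IsDirectedCycle C) (c : E → ℝ) (π : V → ℝ) :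
    ∑ a ∈ C, arcCost (fun e => c e + (π (N.tail e) - π (N.head e))) a = ∑ a ∈ C, arcCost c a := by
  have h := hC.sum_tension π
  rw [← sub_zero (∑ a ∈ C, arcCost c a), ← h, ← Finset.sum_sub_distrib]
  refine Finset.sum_congr rfl fun a _ => ?_
  rcases a with e | e <;> simp [arcCost, arcHead, arcTail] <;> ring

end IsDirectedCycle

/-! ### Walks and feasible potentials. -/

/-- `l` is the list of arcs of a walk from `u` to `v` that uses only arcs of `R`. -/
def IsWalk (N : FlowNetwork V E) (R : Set (E ⊕ E)) : V → List (E ⊕ E) → V → Prop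
  | u, [], v => u = v
  | u, a :: l, v => a ∈ R ∧ N.arcTail a = u ∧ IsWalk N R (N.arcHead a) l v

variable {R : Set (E ⊕ E)}

lemma isWalk_append {u v : V} {l₁ l₂ : List (E ⊕ E)} :
    N.IsWalk R u (l₁ ++ l₂) v ↔ ∃ w, N.IsWalk R u l₁ w ∧ N.IsWalk R w l₂ v := by
  induction l₁ generalizing u with
  | nil => simp [IsWalk]
  | cons a l ih =>
    simp only [List.cons_append, IsWalk, ih]
    constructor
    · rintro ⟨h1, h2, w, h3, h4⟩
      exact ⟨w, ⟨h1, h2, h3⟩, h4⟩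
    · rintro ⟨w, ⟨h1, h2, h3⟩, h4⟩
      exact ⟨h1, h2, w, h3, h4⟩

lemma IsWalk.mem {u v : V} {l : List (E ⊕ E)} (h : N.IsWalk R u l v) : ∀ a ∈ l, a ∈ R := by
  induction l generalizing u with
  | nil => simp
  | cons a l ih =>
    intro b hb
    rcases List.mem_cons.1 hb with rfl | hb
    · exact h.1
    · exact ih h.2.2 b hb

lemma IsWalk.arcTail_zero {u v : V} {l : List (E ⊕ E)} (h : N.IsWalk R u l v)
    (hl : 0 < l.length) : N.arcTail l[0] = u := by
  cases l with
  | nil => simp at hl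
  | cons a l => exact h.2.1

lemma IsWalk.arcHead_last {u v : V} {l : List (E ⊕ E)} (h : N.IsWalk R u l v) {i : ℕ}
    (hi : i + 1 = l.length) : N.arcHead l[i] = v := by
  induction l generalizing u i with
  | nil => simp at hi
  | cons a l ih =>
    cases i with
    | zero =>
      have : l = [] := by
        rw [← List.length_eq_zero_iff]
        simpa using hi.symm
      subst this
      exact h.2.2
    | succ i => exact ih h.2.2 (by simpa using hi)

lemma IsWalk.arcHead_eq_arcTail {u v : V} {l : List (E ⊕ E)} (h : N.IsWalk R u l v) {i : ℕ}
    (hi : i + 1 < l.length) : N.arcHead l[i] = N.arcTail l[i + 1] := by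
  induction l generalizing u i with
  | nil => simp at hi
  | cons a l ih =>
    cases i with
    | zero => exact (h.2.2.arcTail_zero (by simpa using hi)).symm
    | succ i => exact ih h.2.2 (by simpa using hi)

open scoped Classical in
lemma IsWalk.isDirectedCycle {u : V} {l : List (E ⊕ E)} (h : N.IsWalk R u l u) (hl : l ≠ [])
    (hnd : (l.map N.arcTail).Nodup) : N.IsDirectedCycle l.toFinset := by
  obtain ⟨k, hk⟩ : ∃ k, l.length = k + 2 := by
    rcases l with _ | ⟨a, _ | ⟨b, l⟩⟩
    · exact absurd rfl hl
    · exact absurd (h.2.1.trans h.2.2.symm) (N.arcTail_ne_arcHead a)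
    · exact ⟨l.length, rfl⟩
  refine ⟨k, fun i => l[(i : ℕ)]'(by omega), ?_, ?_, ?_⟩
  · intro i j hij
    have := (List.nodup_iff_injective_getElem.1 hnd)
      (a₁ := ⟨i, by simp [hk]⟩) (a₂ := ⟨j, by simp [hk]⟩) (by simpa using hij)
    exact Fin.ext (by simpa using this)
  · intro i
    rcases eq_or_ne i (Fin.last (k + 1)) with rfl | hi
    · rw [h.arcHead_last (by simp [hk])]
      simp only [Fin.last_add_one, Fin.val_zero]
      exact (h.arcTail_zero (by omega)).symm
    · have hval : ((i + 1 : Fin (k + 2)) : ℕ) = i + 1 :=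
        Fin.val_add_one_of_lt (Fin.lt_last_iff_ne_last.2 hi)
      simp only [hval]
      exact h.arcHead_eq_arcTail (by
        have := Fin.val_lt_last hi
        omega)
  · ext a
    simp only [List.coe_toFinset, Set.mem_ofPred_eq, Set.mem_range]
    rw [List.mem_iff_getElem]
    constructor
    · rintro ⟨i, hi, rfl⟩
      exact ⟨⟨i, by omega⟩, rfl⟩
    · rintro ⟨i, rfl⟩
      exact ⟨i, by omega, rfl⟩

lemma exists_split_of_not_nodup_map {α β : Type*} (g : α → β) {l : List α}
    (h : ¬ (l.map g).Nodup) :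
    ∃ l₁ a l₂ b l₃, l = l₁ ++ (a :: l₂ ++ b :: l₃) ∧ g a = g b := by
  induction l with
  | nil => simp at h
  | cons x l ih =>
    rw [List.map_cons, List.nodup_cons, not_and_or, not_not] at h
    rcases h with h | h
    · obtain ⟨b, hb, hxb⟩ := List.mem_map.1 h
      obtain ⟨s, t, rfl⟩ := List.append_of_mem hb
      exact ⟨[], x, s, b, t, rfl, hxb.symm⟩
    · obtain ⟨l₁, a, l₂, b, l₃, rfl, hab⟩ := ih h
      exact ⟨x :: l₁, a, l₂, b, l₃, rfl, hab⟩

lemma IsWalk.exists_split {u v : V} {l : List (E ⊕ E)} (h : N.IsWalk R u l v)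
    (hnd : ¬ (l.map N.arcTail).Nodup) :
    ∃ l₁ l₂ w, N.IsWalk R w l₁ w ∧ N.IsWalk R u l₂ v ∧ l₁ ≠ [] ∧ l₂ ≠ [] ∧
      l₁.length < l.length ∧ l₂.length < l.length ∧
      ∀ g : E ⊕ E → ℝ, (l.map g).sum = (l₁.map g).sum + (l₂.map g).sum := by
  obtain ⟨l₁, a, l₂, b, l₃, rfl, hab⟩ := exists_split_of_not_nodup_map _ hnd
  obtain ⟨w, h1, h2⟩ := isWalk_append.1 h
  obtain ⟨w', h2, h3⟩ := isWalk_append.1 h2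
  obtain rfl : w = w' := by rw [← h2.2.1, hab, h3.2.1]
  refine ⟨a :: l₂, l₁ ++ b :: l₃, w, h2, isWalk_append.2 ⟨w, h1, h3⟩, by simp, by simp,
    by simp; omega, by simp, fun g => ?_⟩
  simp
  ring

lemma IsWalk.sum_nonneg {w : E ⊕ E → ℝ}
    (hw : ∀ C, N.IsDirectedCycle C → (∀ a ∈ C, a ∈ R) → 0 ≤ ∑ a ∈ C, w a)
    {u : V} {l : List (E ⊕ E)} (h : N.IsWalk R u l u) : 0 ≤ (l.map w).sum := by
  classical
  induction hn : l.length using Nat.strong_induction_on generalizing l u with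
  | _ n ih =>
    rcases eq_or_ne l [] with rfl | hl
    · simp
    by_cases hnd : (l.map N.arcTail).Nodup
    · have := hw _ (h.isDirectedCycle hl hnd) (fun a ha => h.mem a (List.mem_toFinset.1 ha))
      rwa [List.sum_toFinset _ hnd.of_map] at this
    · obtain ⟨l₁, l₂, x, h1, h2, -, -, h3, h4, hs⟩ := h.exists_split hnd
      rw [hs]
      exact add_nonneg (ih _ (hn ▸ h3) h1 rfl) (ih _ (hn ▸ h4) h2 rfl)

/-- Cutting out closed subwalks, whose weight is nonnegative, leaves a walk with distinct tails,
which uses each arc at most once. -/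
lemma IsWalk.le_sum [Fintype E] {w : E ⊕ E → ℝ}
    (hw : ∀ C, N.IsDirectedCycle C → (∀ a ∈ C, a ∈ R) → 0 ≤ ∑ a ∈ C, w a)
    {u v : V} {l : List (E ⊕ E)} (h : N.IsWalk R u l v) : -∑ a, |w a| ≤ (l.map w).sum := by
  classical
  induction hn : l.length using Nat.strong_induction_on generalizing l u with
  | _ n ih =>
    by_cases hnd : (l.map N.arcTail).Nodup
    · rw [← List.sum_toFinset _ hnd.of_map, neg_le]
      calc -∑ a ∈ l.toFinset, w a ≤ ∑ a ∈ l.toFinset, |w a| := by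
            rw [← Finset.sum_neg_distrib]
            exact Finset.sum_le_sum fun a _ => neg_le_abs _
        _ ≤ _ := Finset.sum_le_univ_sum_of_nonneg fun a => abs_nonneg _
    · obtain ⟨l₁, l₂, x, h1, h2, -, -, -, h4, hs⟩ := h.exists_split hnd
      rw [hs]
      have := ih _ (hn ▸ h4) h2 rfl
      have := h1.sum_nonneg hw
      linarith

/-- If no directed cycle in `R` has negative weight, then there are feasible potentials. -/
theorem exists_potential [Fintype E] (N : FlowNetwork V E) (R : Set (E ⊕ E)) (w : E ⊕ E → ℝ)
    (hw : ∀ C, N.IsDirectedCycle C → (∀ a ∈ C, a ∈ R) → 0 ≤ ∑ a ∈ C, w a) :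
    ∃ π : V → ℝ, ∀ a ∈ R, π (N.arcHead a) ≤ π (N.arcTail a) + w a := by
  -- Shortest-walk potentials with a free starting node; the empty walk makes each of these sets
  -- nonempty.
  let S : V → Set ℝ := fun v => {x | ∃ u l, N.IsWalk R u l v ∧ (l.map w).sum = x}
  have hbdd : ∀ v, BddBelow (S v) := fun v =>
    ⟨-∑ a, |w a|, by rintro _ ⟨u, l, h, rfl⟩; exact h.le_sum hw⟩
  refine ⟨fun v => sInf (S v), fun a ha => ?_⟩
  rw [← sub_le_iff_le_add]
  refine le_csInf ⟨0, N.arcTail a, [], rfl, by simp⟩ ?_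
  rintro _ ⟨u, l, h, rfl⟩
  rw [sub_le_iff_le_add]
  exact csInf_le (hbdd _) ⟨u, l ++ [a], isWalk_append.2 ⟨_, h, ha, rfl, rfl⟩, by simp⟩

end FlowNetwork

/-! ### Augmentations and single iterations. -/

namespace FlowNetwork

variable {N : FlowNetwork V E} {c f f' : E → ℝ} {C : Finset (E ⊕ E)} {δ : ℝ}

open scoped Classical in
lemma isFlow_iff [Fintype E] :
    N.IsFlow f ↔ (∀ e, 0 ≤ f e ∧ f e ≤ N.cap e) ∧ ∀ v, N.budget v +
      ∑ e, ((if N.head e = v then 1 else 0) - (if N.tail e = v then 1 else 0)) * f e = 0 := by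
  refine and_congr_right fun _ => forall_congr' fun v => ?_
  simp only [sub_mul, ite_mul, one_mul, zero_mul, Finset.sum_sub_distrib, ← Finset.sum_filter]
  rw [← add_sub_assoc, sub_eq_zero]

lemma IsFlow.augment [Fintype E] (hf : N.IsFlow f) (hC : N.IsDirectedCycle C)
    (hb : ∀ e, 0 ≤ augment f C δ e ∧ augment f C δ e ≤ N.cap e) :
    N.IsFlow (augment f C δ) := by
  classical
  rw [isFlow_iff] at hf ⊢
  refine ⟨hb, fun v => ?_⟩
  have h := hC.sum_tension (fun x => if x = v then (1 : ℝ) else 0)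
  simp only [← N.arcCost_tension (fun x => if x = v then (1 : ℝ) else 0)] at h
  rw [sum_arcCost] at h
  have key : ∀ g : E → ℝ, ∑ e, g e * FlowNetwork.augment f C δ e =
      ∑ e, g e * f e + δ * ∑ e, g e * cycleVec C e := fun g => by
    rw [Finset.mul_sum, ← Finset.sum_add_distrib]
    refine Finset.sum_congr rfl fun e _ => ?_
    rw [augment_apply]
    ring
  rw [key, h, mul_zero, add_zero]
  exact hf.2 v

open scoped Classical in
lemma resCap_augment (a : E ⊕ E) :
    N.resCap (augment f C δ) a =
      N.resCap f a - (if a ∈ C then δ else 0) + (if a.swap ∈ C then δ else 0) := by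
  rcases a with e | e <;> by_cases h₁ : Sum.inl e ∈ C <;> by_cases h₂ : Sum.inr e ∈ C <;>
    simp [resCap, augment, h₁, h₂] <;> ring

lemma cap_bounds_iff :
    (∀ e, 0 ≤ f e ∧ f e ≤ N.cap e) ↔ ∀ a, 0 ≤ N.resCap f a := by
  constructor
  · rintro h (e | e)
    · simpa [resCap] using (h e).2
    · exact (h e).1
  · intro h e
    exact ⟨h (Sum.inr e), by simpa [resCap] using h (Sum.inl e)⟩

lemma IsFlow.augment_of_le [Fintype E] (hf : N.IsFlow f) (hC : N.IsDirectedCycle C)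
    (hδ : 0 ≤ δ) (h : ∀ a ∈ C, δ ≤ N.resCap f a) : N.IsFlow (FlowNetwork.augment f C δ) := by
  classical
  refine hf.augment hC (cap_bounds_iff.2 fun a => ?_)
  have := cap_bounds_iff.1 hf.1 a
  rw [resCap_augment]
  by_cases ha : a ∈ C
  · have := h a ha
    split_ifs <;> linarith
  · split_ifs <;> linarith

lemma IsFlow.augment_neg_of_le [Fintype E] (hf : N.IsFlow f) (hC : N.IsDirectedCycle C)
    (hδ : 0 ≤ δ) (h : ∀ a ∈ C, δ ≤ N.resCap f a.swap) :
    N.IsFlow (FlowNetwork.augment f C (-δ)) := by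
  classical
  refine hf.augment hC (cap_bounds_iff.2 fun a => ?_)
  have := cap_bounds_iff.1 hf.1 a
  rw [resCap_augment]
  by_cases ha : a.swap ∈ C
  · have := h a.swap ha
    rw [Sum.swap_swap] at this
    split_ifs <;> linarith
  · split_ifs <;> linarith

lemma cost_augment [Fintype E] (c : E → ℝ) :
    ∑ e, c e * augment f C δ e = ∑ e, c e * f e + δ * ∑ a ∈ C, arcCost c a := by
  rw [sum_arcCost, Finset.mul_sum, ← Finset.sum_add_distrib]
  refine Finset.sum_congr rfl fun e _ => ?_
  rw [augment_apply]
  ring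

/-- `f'` arises from `f` by canceling the negative cycle `C` of minimum mean cost. -/
def IsIteration (N : FlowNetwork V E) (c f : E → ℝ) (C : Finset (E ⊕ E)) (f' : E → ℝ) : Prop :=
  N.IsMinMeanCycle c f C ∧ meanCost c C < 0 ∧
    ∃ δ, IsLeast (N.resCap f '' C) δ ∧ f' = augment f C δ

lemma Step.exists_isIteration (h : N.Step c f f') : ∃ C, N.IsIteration c f C f' := by
  obtain ⟨⟨D, hD, hneg⟩, C, δ, hC, hδ, rfl⟩ := h
  exact ⟨C, hC, (hC.2 D hD).trans_lt (div_neg_of_neg_of_pos hneg hD.1.card_pos), δ, hδ, rfl⟩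

lemma exists_pos_of_isLeast (hC : N.IsResidualCycle f C) (h : IsLeast (N.resCap f '' C) δ) :
    0 < δ := by
  obtain ⟨a, ha, rfl⟩ := h.1
  exact hC.2 a ha

lemma IsIteration.isFlow [Fintype E] (h : N.IsIteration c f C f') (hf : N.IsFlow f) :
    N.IsFlow f' := by
  obtain ⟨hC, -, δ, hδ, rfl⟩ := h
  exact hf.augment_of_le hC.1.1 (exists_pos_of_isLeast hC.1 hδ).le
    fun a ha => hδ.2 ⟨a, ha, rfl⟩

lemma IsIteration.sum_neg (h : N.IsIteration c f C f') : ∑ a ∈ C, arcCost c a < 0 := by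
  have := h.2.1
  rwa [meanCost, div_lt_iff₀ h.1.1.1.card_pos, zero_mul] at this

lemma IsIteration.cost_lt [Fintype E] (h : N.IsIteration c f C f') :
    ∑ e, c e * f' e < ∑ e, c e * f e := by
  have hneg := h.sum_neg
  obtain ⟨hC, -, δ, hδ, rfl⟩ := h
  rw [cost_augment]
  have := mul_neg_of_pos_of_neg (exists_pos_of_isLeast hC.1 hδ) hneg
  linarith

lemma IsIteration.resCap_pos (h : N.IsIteration c f C f') {a : E ⊕ E}
    (ha : 0 < N.resCap f' a) : 0 < N.resCap f a ∨ a.swap ∈ C := by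
  classical
  obtain ⟨hC, -, δ, hδ, rfl⟩ := h
  have hpos := exists_pos_of_isLeast hC.1 hδ
  by_contra! hcon
  rw [resCap_augment, if_neg hcon.2] at ha
  split_ifs at ha <;> linarith [hcon.1]

lemma le_meanCost (hC : C.Nonempty) {x : ℝ} (h : ∀ a ∈ C, x ≤ arcCost c a) :
    x ≤ meanCost c C := by
  rw [meanCost, le_div_iff₀ (by exact_mod_cast hC.card_pos), mul_comm, ← nsmul_eq_mul]
  exact Finset.card_nsmul_le_sum _ _ _ h

lemma meanCost_mul_card (hC : C.Nonempty) : C.card * meanCost c C = ∑ a ∈ C, arcCost c a :=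
  mul_div_cancel₀ _ (by exact_mod_cast hC.card_pos.ne')

/-- `c'` assigns the same costs as `c` to all directed cycles. -/
def CycleEquiv (N : FlowNetwork V E) (c c' : E → ℝ) : Prop :=
  ∀ C, N.IsDirectedCycle C → ∑ a ∈ C, arcCost c' a = ∑ a ∈ C, arcCost c a

lemma CycleEquiv.meanCost_eq {c' : E → ℝ} (h : N.CycleEquiv c c') (hC : N.IsDirectedCycle C) :
    meanCost c' C = meanCost c C := by
  rw [meanCost, meanCost, h C hC]

/-- After subtracting μ from every arc cost no residual cycle is negative, so feasible potentials
exist. -/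
lemma IsMinMeanCycle.exists_reduced [Fintype E] (h : N.IsMinMeanCycle c f C) :
    ∃ c', N.CycleEquiv c c' ∧ ∀ a, 0 < N.resCap f a → meanCost c C ≤ arcCost c' a := by
  obtain ⟨π, hπ⟩ := N.exists_potential {a | 0 < N.resCap f a}
    (fun a => arcCost c a - meanCost c C) (fun D hD hR => by
      have := mul_le_mul_of_nonneg_left (h.2 D ⟨hD, hR⟩) hD.card_pos.le
      rw [meanCost_mul_card hD.nonempty] at this
      simpa using this)
  refine ⟨fun e => c e + (π (N.tail e) - π (N.head e)),
    fun D hD => hD.sum_arcCost_reduced c π, fun a ha => ?_⟩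
  have := hπ a ha
  rcases a with e | e <;> simp [arcCost, arcHead, arcTail] at this ⊢ <;> linarith

/-- The average of the reduced costs on `C` equals their lower bound. -/
lemma IsMinMeanCycle.arcCost_eq {c' : E → ℝ} (h : N.IsMinMeanCycle c f C)
    (hc : N.CycleEquiv c c') (hle : ∀ a, 0 < N.resCap f a → meanCost c C ≤ arcCost c' a) :
    ∀ a ∈ C, arcCost c' a = meanCost c C := by
  have hle' : ∀ a ∈ C, meanCost c C ≤ arcCost c' a := fun a ha => hle a (h.1.2 a ha)
  have hsum : ∑ _a ∈ C, meanCost c C = ∑ a ∈ C, arcCost c' a := by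
    rw [hc C h.1.1, ← meanCost_mul_card h.1.1.nonempty]
    simp
  exact fun a ha => ((Finset.sum_eq_sum_iff_of_le hle').1 hsum a ha).symm

/-- The mean cost of the canceled cycles is nondecreasing. -/
lemma IsIteration.meanCost_le [Fintype E] (h : N.IsIteration c f C f') {D : Finset (E ⊕ E)}
    (hD : N.IsResidualCycle f' D) : meanCost c C ≤ meanCost c D := by
  obtain ⟨c', hc, hle⟩ := h.1.exists_reduced
  have heq := h.1.arcCost_eq hc hle
  rw [← hc.meanCost_eq hD.1]
  refine le_meanCost hD.1.nonempty fun a ha => ?_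
  rcases h.resCap_pos (hD.2 a ha) with h1 | h1
  · exact hle a h1
  -- A new residual arc reverses an arc of `C`, so its reduced cost is -μ > 0 > μ.
  · have h2 := heq _ h1
    rw [arcCost_swap] at h2
    linarith [h.2.1]

open scoped Classical in
/-- The residual arcs of negative cost. -/
noncomputable def negArcs [Fintype E] (N : FlowNetwork V E) (c f : E → ℝ) : Finset (E ⊕ E) :=
  {a | 0 < N.resCap f a ∧ arcCost c a < 0}

lemma mem_negArcs [Fintype E] {a : E ⊕ E} :
    a ∈ N.negArcs c f ↔ 0 < N.resCap f a ∧ arcCost c a < 0 := by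
  simp [negArcs]

/-- An edge and its reversal have opposite costs, so at most one of them counts. -/
lemma card_negArcs_le [Fintype E] : (N.negArcs c f).card ≤ Fintype.card E := by
  classical
  rw [← Finset.card_image_of_injOn (f := Sum.elim id id) (s := N.negArcs c f)]
  · exact Finset.card_le_univ _
  · intro a ha b hb hab
    have ha := (mem_negArcs.1 ha).2
    have hb := (mem_negArcs.1 hb).2
    rcases a with a | a <;> rcases b with b | b <;> simp [arcCost] at hab ha hb ⊢ <;>
      first | exact hab | (subst hab; linarith)

/-- The bottleneck arc is saturated and leaves; new residual arcs reverse negative arcs, so they are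
positive. -/
lemma IsIteration.negArcs_ssubset [Fintype E] {c' : E → ℝ} (h : N.IsIteration c f C f')
    (hneg : ∀ a ∈ C, arcCost c' a < 0) : N.negArcs c' f' ⊂ N.negArcs c' f := by
  classical
  rw [Finset.ssubset_iff_of_subset]
  · obtain ⟨hC, -, δ, hδ, rfl⟩ := h
    obtain ⟨a, ha, had⟩ := hδ.1
    rw [Finset.mem_coe] at ha
    refine ⟨a, mem_negArcs.2 ⟨hC.1.2 a ha, hneg a ha⟩, fun hcon => ?_⟩
    have h1 := (mem_negArcs.1 hcon).1
    have hswap : a.swap ∉ C := fun hs => by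
      have h2 := hneg _ hs
      rw [arcCost_swap] at h2
      linarith [hneg a ha]
    rw [resCap_augment, if_pos ha, if_neg hswap, had] at h1
    linarith
  · intro a ha
    rw [mem_negArcs] at ha ⊢
    refine ⟨(h.resCap_pos ha.1).resolve_right fun hs => ?_, ha.2⟩
    have h2 := hneg _ hs
    rw [arcCost_swap] at h2
    linarith [ha.2]

/-- All arcs but one contribute at least `x` and that one at least 0, so the mean is at least (1 -
1/|C|) x; moreover |C| ≤ n and `x` ≤ 0. -/
lemma le_meanCost_of_nonneg_arc [Fintype V] {x : ℝ} (hx : x ≤ 0) (hC : N.IsDirectedCycle C)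
    (hle : ∀ a ∈ C, x ≤ arcCost c a) {a : E ⊕ E} (ha : a ∈ C) (h0 : 0 ≤ arcCost c a) :
    (1 - 1 / (Fintype.card V : ℝ)) * x ≤ meanCost c C := by
  classical
  have hpos := hC.card_pos
  have hcard : (C.card : ℝ) ≤ Fintype.card V := by exact_mod_cast hC.card_le
  have h1 : ((C.erase a).card : ℝ) * x ≤ ∑ b ∈ C.erase a, arcCost c b := by
    rw [← nsmul_eq_mul]
    exact Finset.card_nsmul_le_sum _ _ _ fun b hb => hle b (Finset.mem_of_mem_erase hb)
  rw [Finset.card_erase_of_mem ha, Nat.cast_sub hC.nonempty.card_pos, Nat.cast_one] at h1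
  calc (1 - 1 / (Fintype.card V : ℝ)) * x ≤ (1 - 1 / (C.card : ℝ)) * x := by
        refine mul_le_mul_of_nonpos_right ?_ hx
        gcongr
    _ = ((C.card - 1 : ℝ) * x) / C.card := by field_simp
    _ ≤ meanCost c C := by
        rw [meanCost]
        gcongr
        rw [← Finset.add_sum_erase _ _ ha]
        linarith

/-- As long as only cycles of negative arcs are canceled, the number of negative arcs shrinks. -/
lemma exists_le_meanCost [Fintype V] [Fintype E] {c' : E → ℝ} {x : ℝ} (hx : x ≤ 0)
    (hc : N.CycleEquiv c c') (p k : ℕ) (f : ℕ → E → ℝ) (C : ℕ → Finset (E ⊕ E))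
    (hle : ∀ a, 0 < N.resCap (f 0) a → x ≤ arcCost c' a)
    (hcard : (N.negArcs c' (f 0)).card ≤ p) (hpk : p < k)
    (hit : ∀ i < k, N.IsIteration c (f i) (C i) (f (i + 1))) :
    ∃ i ≤ p, (1 - 1 / (Fintype.card V : ℝ)) * x ≤ meanCost c (C i) := by
  induction p generalizing k f C with
  | zero =>
    have h0 := hit 0 hpk
    refine ⟨0, le_rfl, ?_⟩
    obtain ⟨a, ha⟩ := h0.1.1.1.nonempty
    rw [← hc.meanCost_eq h0.1.1.1]
    refine le_meanCost_of_nonneg_arc hx h0.1.1.1 (fun b hb => hle b (h0.1.1.2 b hb)) ha ?_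
    by_contra! hcon
    have : a ∈ N.negArcs c' (f 0) := mem_negArcs.2 ⟨h0.1.1.2 a ha, hcon⟩
    rw [Finset.card_eq_zero.1 (Nat.le_zero.1 hcard)] at this
    simp at this
  | succ p ih =>
    have h0 := hit 0 (by omega)
    by_cases hneg : ∀ a ∈ C 0, arcCost c' a < 0
    · have hss := Finset.card_lt_card (h0.negArcs_ssubset hneg)
      obtain ⟨i, hi, h⟩ := ih (k - 1) (fun i => f (i + 1)) (fun i => C (i + 1)) (fun a ha => by
        rcases h0.resCap_pos ha with h1 | h1
        · exact hle a h1
        · have h2 := hneg _ h1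
          rw [arcCost_swap] at h2
          linarith) (by simp only [zero_add] at hss ⊢; omega) (by omega)
          (fun i hi => hit (i + 1) (by omega))
      exact ⟨i + 1, by omega, h⟩
    · push Not at hneg
      obtain ⟨a, ha, h⟩ := hneg
      refine ⟨0, by omega, ?_⟩
      rw [← hc.meanCost_eq h0.1.1.1]
      exact le_meanCost_of_nonneg_arc hx h0.1.1.1 (fun b hb => hle b (h0.1.1.2 b hb)) ha h

/-! ### Geometric decrease of the minimum mean cost along a run. -/

section Run

variable {k : ℕ} {f : ℕ → E → ℝ} {C : ℕ → Finset (E ⊕ E)}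

lemma meanCost_mono [Fintype E] (hit : ∀ i < k, N.IsIteration c (f i) (C i) (f (i + 1)))
    {i j : ℕ} (hij : i ≤ j) (hj : j < k) : meanCost c (C i) ≤ meanCost c (C j) := by
  induction j, hij using Nat.le_induction with
  | base => exact le_rfl
  | succ j hij ih => exact (ih (by omega)).trans ((hit j (by omega)).meanCost_le (hit _ hj).1.1)

lemma meanCost_contract [Fintype V] [Fintype E]
    (hit : ∀ i < k, N.IsIteration c (f i) (C i) (f (i + 1))) {i : ℕ}
    (hi : i + Fintype.card E < k) :
    (1 - 1 / (Fintype.card V : ℝ)) * meanCost c (C i) ≤ meanCost c (C (i + Fintype.card E)) := by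
  obtain ⟨c', hc, hle⟩ := (hit i (by omega)).1.exists_reduced
  obtain ⟨j, hj, h⟩ := exists_le_meanCost (hit i (by omega)).2.1.le hc (Fintype.card E) (k - i)
    (fun j => f (i + j)) (fun j => C (i + j)) hle card_negArcs_le (by omega)
    (fun j hj => hit (i + j) (by omega))
  exact h.trans (meanCost_mono hit (by omega) hi)

lemma pow_mul_meanCost_le [Fintype V] [Fintype E] [Nonempty V]
    (hit : ∀ i < k, N.IsIteration c (f i) (C i) (f (i + 1))) (t : ℕ)
    (ht : Fintype.card E * t < k) :
    (1 - 1 / (Fintype.card V : ℝ)) ^ t * meanCost c (C 0) ≤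
      meanCost c (C (Fintype.card E * t)) := by
  induction t with
  | zero => simp
  | succ t ih =>
    have h1 := meanCost_contract hit (i := Fintype.card E * t) (by rw [mul_add] at ht; omega)
    have hn : (1 : ℝ) ≤ Fintype.card V := by exact_mod_cast Fintype.card_pos
    have h0 : 0 ≤ 1 - 1 / (Fintype.card V : ℝ) := by
      rw [sub_nonneg, div_le_one (by linarith)]
      exact hn
    have h2 := mul_le_mul_of_nonneg_left
      (ih (by have : Fintype.card E * t ≤ Fintype.card E * (t + 1) := by gcongr; omega
              omega)) h0
    rw [pow_succ', mul_assoc]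
    exact h2.trans h1

/-- Every `m n` iterations halve the absolute value of the minimum mean cost. -/
lemma neg_half_pow_le_meanCost [Fintype V] [Fintype E] [Nonempty V]
    (hcost : ∀ e, c e ∈ Set.Icc (0 : ℝ) 1)
    (hit : ∀ i < k, N.IsIteration c (f i) (C i) (f (i + 1))) (L : ℕ)
    (hL : Fintype.card E * (Fintype.card V * L) < k) :
    -(1 / 2) ^ L ≤ meanCost c (C (Fintype.card E * (Fintype.card V * L))) := by
  refine le_trans ?_ (pow_mul_meanCost_le hit _ hL)
  have hn : (1 : ℝ) ≤ Fintype.card V := by exact_mod_cast Fintype.card_pos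
  have h0 : 0 ≤ 1 - 1 / (Fintype.card V : ℝ) := by
    rw [sub_nonneg, div_le_one (by linarith)]
    exact hn
  have h1 : -1 ≤ meanCost c (C 0) := by
    refine le_meanCost (hit 0 (by omega)).1.1.1.nonempty fun a _ => ?_
    rcases a with e | e
    · have := (hcost e).1
      simp only [arcCost, Sum.elim_inl]
      linarith
    · have := (hcost e).2
      simp only [arcCost, Sum.elim_inr]
      linarith
  -- The power is at most 1/e, and e ≥ 2.
  have h2 : (1 - 1 / (Fintype.card V : ℝ)) ^ Fintype.card V ≤ 1 / 2 := by
    refine (Real.one_sub_div_pow_le_exp_neg (t := 1) hn).trans ?_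
    rw [Real.exp_neg, one_div]
    gcongr
    linarith [Real.add_one_le_exp 1]
  rw [pow_mul]
  have h3 : ((1 - 1 / (Fintype.card V : ℝ)) ^ Fintype.card V) ^ L ≤ (1 / 2) ^ L := by gcongr
  have h4 : 0 ≤ ((1 - 1 / (Fintype.card V : ℝ)) ^ Fintype.card V) ^ L := by positivity
  nlinarith

end Run

end FlowNetwork

/-! ### Long runs force degenerate costs. -/

lemma exists_pos_le_of_forall_pos {α : Type*} {s : Finset α} (hs : s.Nonempty) {g : α → ℝ}
    (h : ∀ a ∈ s, 0 < g a) : ∃ δ > 0, ∀ a ∈ s, δ ≤ g a := by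
  obtain ⟨a, ha, hmin⟩ := s.exists_min_image g hs
  exact ⟨g a, h a ha, hmin⟩

lemma abs_cycleVec_eq_one {C : Finset (E ⊕ E)} {a : E ⊕ E} (ha : a ∈ C) (hs : a.swap ∉ C) :
    |cycleVec C (Sum.elim id id a)| = 1 := by
  rcases a with e | e <;> simp at hs <;> simp [cycleVec, ha, hs]

/-- The costs for which some minimizer over `S` has `e`-th coordinate `b`, but changing that
coordinate costs less than `r` per unit. -/
def nearTie [Fintype E] (S : Set (E → ℝ)) (e : E) (b r : ℝ) : Set (E → ℝ) :=
  {c | ∃ f ∈ S, f e = b ∧ ∀ g ∈ S, ∑ i, c i * f i ≤ ∑ i, c i * g i} ∩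
  {c | ∃ f ∈ S, f e ≠ b ∧ ∀ g ∈ S, g e = b → ∑ i, c i * f i < ∑ i, c i * g i + r * |f e - b|}

namespace FlowNetwork

variable {N : FlowNetwork V E} {c f f' g : E → ℝ} {C : Finset (E ⊕ E)}

lemma isCompact_isFlow [Fintype E] (N : FlowNetwork V E) : IsCompact {f | N.IsFlow f} := by
  classical
  have hbox := isCompact_univ_pi (fun e => isCompact_Icc (a := (0 : ℝ)) (b := N.cap e))
  refine hbox.of_isClosed_subset ?_ fun f hf e _ => hf.1 e
  have : {f | N.IsFlow f} = (⋂ e, {f | 0 ≤ f e} ∩ {f : E → ℝ | f e ≤ N.cap e}) ∩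
      ⋂ v, {f : E → ℝ | N.budget v + ∑ e with N.head e = v, f e = ∑ e with N.tail e = v, f e} := by
    ext f
    simp only [Set.mem_inter_iff, Set.mem_iInter, Set.mem_ofPred_eq, IsFlow]
  rw [this]
  refine (isClosed_iInter fun e => (isClosed_le ?_ ?_).inter (isClosed_le ?_ ?_)).inter
    (isClosed_iInter fun v => isClosed_eq ?_ ?_) <;> fun_prop

/-- Flow conservation summed against π. The value does not depend on the flow, so potential
differences are orthogonal to the difference of two flows. -/
lemma IsFlow.sum_tension [Fintype V] [Fintype E] (hf : N.IsFlow f) (π : V → ℝ) :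
    ∑ e, (π (N.head e) - π (N.tail e)) * f e = -∑ v, π v * N.budget v := by
  classical
  have h : ∑ v, π v * (N.budget v +
      ∑ e, ((if N.head e = v then 1 else 0) - (if N.tail e = v then 1 else 0)) * f e) = 0 :=
    Finset.sum_eq_zero fun v _ => by rw [(isFlow_iff.1 hf).2 v, mul_zero]
  simp only [mul_add, Finset.sum_add_distrib, Finset.mul_sum] at h
  rw [Finset.sum_comm] at h
  rw [eq_neg_iff_add_eq_zero, add_comm, ← h]
  congr 1
  refine Finset.sum_congr rfl fun e _ => ?_
  simp only [← mul_assoc, ← Finset.sum_mul]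
  simp [mul_sub]

/-- The support of the difference of two flows contains a directed cycle. -/
lemma exists_cycle_of_ne [Fintype V] [Fintype E] (hf : N.IsFlow f) (hg : N.IsFlow g)
    (hne : f ≠ g) :
    ∃ D, N.IsDirectedCycle D ∧ ∀ a ∈ D, 0 < arcCost (fun e => g e - f e) a := by
  by_contra! hcon
  -- With weight -1, π drops by at least 1 along every arc of the support, which contradicts
  -- orthogonality unless the flows agree.
  obtain ⟨π, hπ⟩ := N.exists_potential {a | 0 < arcCost (fun e => g e - f e) a} (fun _ => -1)
    (fun D hD hR => by
      obtain ⟨a, ha, h⟩ := hcon D hD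
      exact absurd (hR a ha) (not_lt.2 h))
  have hle : ∀ e, (π (N.head e) - π (N.tail e)) * (g e - f e) ≤ -|g e - f e| := fun e => by
    rcases lt_trichotomy (g e - f e) 0 with h | h | h
    · have := hπ (Sum.inr e) (by simpa [arcCost] using h)
      simp only [arcHead, arcTail, Sum.elim_inr] at this
      rw [abs_of_neg h]
      nlinarith
    · simp [h]
    · have := hπ (Sum.inl e) (by simpa [arcCost] using h)
      simp only [arcHead, arcTail, Sum.elim_inl] at this
      rw [abs_of_pos h]
      nlinarith
  have hsum := Finset.sum_le_sum fun e (_ : e ∈ Finset.univ) => hle e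
  simp only [mul_sub, Finset.sum_sub_distrib, hf.sum_tension, hg.sum_tension, sub_self,
    Finset.sum_neg_distrib] at hsum
  have h0 : ∑ e, |g e - f e| = 0 :=
    le_antisymm (by linarith) (Finset.sum_nonneg fun e _ => abs_nonneg _)
  refine hne (funext fun e => ?_)
  have := (Finset.sum_eq_zero_iff_of_nonneg fun e _ => abs_nonneg _).1 h0 e (Finset.mem_univ e)
  linarith [abs_eq_zero.1 this]

/-- If a nonoptimal flow has minimum mean cost at least `-ε`, then there is a cycle of cost zero, or
for some edge the optimum at one of the bounds is nearly tied. -/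
theorem IsIteration.exists_zero_cycle_or_nearTie [Fintype V] [Fintype E] (hf : N.IsFlow f)
    (h : N.IsIteration c f C f') {ε : ℝ} (hε : 0 < ε) (hC : -ε ≤ meanCost c C) :
    (∃ D, (∃ e, cycleVec D e ≠ 0) ∧ ∑ e, c e * cycleVec D e = 0) ∨
      ∃ e, c ∈ nearTie {f | N.IsFlow f} e 0 (2 * Fintype.card V * ε) ∨
        c ∈ nearTie {f | N.IsFlow f} e (N.cap e) (2 * Fintype.card V * ε) := by
  obtain ⟨g, hg, hopt⟩ := N.isCompact_isFlow.exists_isMinOn ⟨f, hf⟩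
    (f := fun g => ∑ e, c e * g e) (by fun_prop)
  replace hopt : ∀ g', N.IsFlow g' → ∑ e, c e * g e ≤ ∑ e, c e * g' e := fun g' hg' => hopt hg'
  have hne : f ≠ g := by
    rintro rfl
    exact absurd h.cost_lt (not_lt.2 (hopt _ (h.isFlow hf)))
  obtain ⟨D, hD, hpos⟩ := exists_cycle_of_ne hf hg hne
  obtain ⟨δ, hδ, hle⟩ := exists_pos_le_of_forall_pos hD.nonempty hpos
  have hres : ∀ a, arcCost (fun e => g e - f e) a ≤ N.resCap f a := by
    rintro (e | e)
    · simpa [arcCost, resCap] using (hg.1 e).2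
    · simpa [arcCost, resCap] using (hg.1 e).1
  have hres' : ∀ a, arcCost (fun e => g e - f e) a ≤ N.resCap g a.swap := by
    rintro (e | e)
    · simpa [arcCost, resCap] using (hf.1 e).1
    · simpa [arcCost, resCap] using (hf.1 e).2
  -- This excludes the 2-cycle of an edge and its reversal, whose `cycleVec` is zero.
  have hswap : ∀ a ∈ D, a.swap ∉ D := fun a ha hs => by
    have h1 := hpos _ hs
    rw [arcCost_swap] at h1
    linarith [hpos a ha]
  have hmean : -(Fintype.card V * ε) ≤ ∑ a ∈ D, arcCost c a := by
    have h1 := hC.trans (h.1.2 D ⟨hD, fun a ha => (hpos a ha).trans_le (hres a)⟩)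
    rw [meanCost, le_div_iff₀ hD.card_pos] at h1
    have h2 : (D.card : ℝ) * ε ≤ Fintype.card V * ε := by
      gcongr
      exact_mod_cast hD.card_le
    linarith
  have hflow : N.IsFlow (augment g D (-δ)) :=
    hg.augment_neg_of_le hD hδ.le fun a ha => (hle a ha).trans (hres' a)
  have hcost := cost_augment (f := g) (C := D) (δ := -δ) c
  have hVpos : 0 < (Fintype.card V : ℝ) := hD.card_pos.trans_le (by exact_mod_cast hD.card_le)
  have key : ∀ a ∈ D, ∀ b, g (Sum.elim id id a) = b →
      c ∈ nearTie {f | N.IsFlow f} (Sum.elim id id a) b (2 * Fintype.card V * ε) := by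
    intro a ha b hb
    have habs : |augment g D (-δ) (Sum.elim id id a) - b| = δ := by
      rw [augment_apply, hb, add_sub_cancel_left, abs_mul, abs_cycleVec_eq_one ha (hswap a ha),
        abs_neg, abs_of_pos hδ, mul_one]
    refine ⟨⟨g, hg, hb, hopt⟩, augment g D (-δ), hflow, fun heq => ?_, fun g' hg' _ => ?_⟩
    · rw [heq, sub_self, abs_zero] at habs
      exact hδ.ne habs
    · rw [hcost, habs]
      have h1 := hopt g' hg'
      have h2 := mul_le_mul_of_nonneg_left hmean hδ.le
      -- The factor 2 in the radius supplies the strict inequality in `nearTie`: nεδ < 2nεδ.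
      have h3 : 0 < Fintype.card V * ε * δ := by positivity
      linarith
  by_cases hb : ∃ a ∈ D, g (Sum.elim id id a) = 0 ∨ g (Sum.elim id id a) = N.cap (Sum.elim id id a)
  · obtain ⟨a, ha, hb | hb⟩ := hb
    · exact Or.inr ⟨_, Or.inl (key a ha _ hb)⟩
    · exact Or.inr ⟨_, Or.inr (key a ha _ hb)⟩
  · push Not at hb
    have hint : ∀ a ∈ D, 0 < N.resCap g a := by
      intro a ha
      obtain ⟨h0, hcap⟩ := hb a ha
      rcases a with e | e
      · exact sub_pos.2 (lt_of_le_of_ne (hg.1 e).2 hcap)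
      · exact lt_of_le_of_ne (hg.1 e).1 (Ne.symm h0)
    obtain ⟨δ', hδ', hle'⟩ := exists_pos_le_of_forall_pos hD.nonempty hint
    have h1 := hopt _ (hg.augment_of_le hD hδ'.le hle')
    have h2 := hopt _ hflow
    rw [cost_augment] at h1 h2
    have h3 : 0 ≤ δ' * ∑ a ∈ D, arcCost c a := by linarith
    have h4 : 0 ≤ δ * -∑ a ∈ D, arcCost c a := by linarith
    obtain ⟨a, ha⟩ := hD.nonempty
    refine Or.inl ⟨D, ⟨Sum.elim id id a, fun h0 => ?_⟩, ?_⟩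
    · have := abs_cycleVec_eq_one ha (hswap a ha)
      rw [h0, abs_zero] at this
      exact zero_ne_one this
    · rw [← sum_arcCost]
      have h5 := nonneg_of_mul_nonneg_right h3 hδ'
      have h6 := nonneg_of_mul_nonneg_right h4 hδ
      linarith

lemma HasRun.exists_isIteration [Fintype E] {k : ℕ} (h : N.HasRun c k) :
    ∃ (f : ℕ → E → ℝ) (C : ℕ → Finset (E ⊕ E)), (∀ i ≤ k, N.IsFlow (f i)) ∧
      ∀ i < k, N.IsIteration c (f i) (C i) (f (i + 1)) := by
  obtain ⟨f, h0, hstep⟩ := h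
  have h1 : ∀ i, ∃ C, i < k → N.IsIteration c (f i) C (f (i + 1)) := fun i => by
    by_cases hi : i < k
    · obtain ⟨C, hC⟩ := (hstep i hi).exists_isIteration
      exact ⟨C, fun _ => hC⟩
    · exact ⟨∅, fun h => absurd h hi⟩
  choose C hC using h1
  refine ⟨f, C, fun i hi => ?_, hC⟩
  induction i with
  | zero => exact h0
  | succ i ih => exact (hC i (by omega)).isFlow (ih (by omega))

lemma HasRun.mono [Fintype E] {k l : ℕ} (h : N.HasRun c k) (hlk : l ≤ k) : N.HasRun c l := by
  obtain ⟨f, h0, hstep⟩ := h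
  exact ⟨f, h0, fun i hi => hstep i (by omega)⟩

/-- A long run is possible only for degenerate costs. -/
theorem HasRun.exists_zero_cycle_or_nearTie [Fintype V] [Fintype E] [Nonempty V]
    (hcost : ∀ e, c e ∈ Set.Icc (0 : ℝ) 1) {L : ℕ}
    (h : N.HasRun c (Fintype.card E * (Fintype.card V * L) + 1)) :
    (∃ D, (∃ e, cycleVec D e ≠ 0) ∧ ∑ e, c e * cycleVec D e = 0) ∨
      ∃ e, c ∈ nearTie {f | N.IsFlow f} e 0 (2 * Fintype.card V * (1 / 2) ^ L) ∨
        c ∈ nearTie {f | N.IsFlow f} e (N.cap e) (2 * Fintype.card V * (1 / 2) ^ L) := by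
  obtain ⟨f, C, hf, hit⟩ := h.exists_isIteration
  exact (hit _ (Nat.lt_succ_self _)).exists_zero_cycle_or_nearTie (hf _ (Nat.le_succ _))
    (by positivity) (neg_half_pow_le_meanCost hcost hit L (Nat.lt_succ_self _))

lemma iterations_eq_zero_of_isEmpty [Fintype E] [IsEmpty E] (N : FlowNetwork V E) (c : E → ℝ) :
    N.iterations c = 0 := by
  simp only [iterations, ENNReal.iSup_eq_zero, Nat.cast_eq_zero]
  intro k hk
  by_contra h0
  obtain ⟨f, C, -, hit⟩ := hk.exists_isIteration
  obtain ⟨a, -⟩ := (hit 0 (Nat.pos_of_ne_zero h0)).1.1.1.nonempty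
  exact isEmptyElim a

end FlowNetwork

/-! ### Probability of near ties and of zero-cost cycles. -/

section Fiber

variable [Fintype E] {ν : E → Measure ℝ} [∀ e, IsProbabilityMeasure (ν e)] {A : Set (E → ℝ)}

open scoped Classical in
-- Fubini: integrate over coordinate `e` first.
lemma pi_measure_le_of_fiber (hA : MeasurableSet A) (e : E) (K : ℝ≥0∞)
    (h : ∀ x, ν e {t | Function.update x e t ∈ A} ≤ K) : Measure.pi ν A ≤ K := by
  rw [← lintegral_indicator_one hA]
  calc ∫⁻ x, A.indicator 1 x ∂Measure.pi ν ≤ ∫⁻ _x, K ∂Measure.pi ν := by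
        refine lintegral_le_of_lmarginal_le {e} (measurable_one.indicator hA) measurable_const ?_
        rw [lmarginal_singleton, lmarginal_singleton]
        intro x
        have hm : MeasurableSet {t | Function.update x e t ∈ A} := measurable_update x hA
        have hi : ∀ t, A.indicator (1 : (E → ℝ) → ℝ≥0∞) (Function.update x e t) =
            {t | Function.update x e t ∈ A}.indicator 1 t := fun t => rfl
        simp only [hi]
        rw [lintegral_indicator_one hm]
        simpa using h x
    _ = K := by simp

open scoped Classical in
lemma pi_measure_le_of_fiber_dist {φ : ℝ}
    (hν : ∀ e, ν e ≤ ENNReal.ofReal φ • volume.restrict (Set.Icc (0 : ℝ) 1))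
    (hA : MeasurableSet A) (e : E) (r : ℝ)
    (h : ∀ x t t', Function.update x e t ∈ A → Function.update x e t' ∈ A → |t - t'| ≤ r) :
    Measure.pi ν A ≤ ENNReal.ofReal φ * ENNReal.ofReal r := by
  refine pi_measure_le_of_fiber hA e _ fun x => (hν e _).trans ?_
  rw [Measure.smul_apply, smul_eq_mul]
  gcongr
  refine (Measure.restrict_apply_le _ _).trans ((Real.volume_le_diam _).trans ?_)
  refine Metric.ediam_le fun t ht t' ht' => ?_
  rw [edist_dist, Real.dist_eq]
  exact ENNReal.ofReal_le_ofReal (h x t t' ht ht')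

lemma ae_mem_Icc {φ : ℝ}
    (hν : ∀ e, ν e ≤ ENNReal.ofReal φ • volume.restrict (Set.Icc (0 : ℝ) 1)) :
    ∀ᵐ x ∂Measure.pi ν, ∀ e, x e ∈ Set.Icc (0 : ℝ) 1 := by
  refine ae_all_iff.2 fun e => ?_
  have h : ∀ᵐ t ∂ν e, t ∈ Set.Icc (0 : ℝ) 1 :=
    (Measure.absolutelyContinuous_of_le_smul (hν e)).ae_le (ae_restrict_mem measurableSet_Icc)
  exact Measure.tendsto_eval_ae_ae.eventually h

lemma one_le_of_le_smul {φ : ℝ} {μ : Measure ℝ} [IsProbabilityMeasure μ]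
    (hμ : μ ≤ ENNReal.ofReal φ • volume.restrict (Set.Icc (0 : ℝ) 1)) : 1 ≤ φ := by
  simpa using hμ Set.univ

open scoped Classical in
lemma sum_update_mul (x y : E → ℝ) (e : E) (t t' : ℝ) :
    ∑ i, Function.update x e t' i * y i =
      ∑ i, Function.update x e t i * y i + (t' - t) * y e := by
  rw [← Finset.add_sum_erase _ _ (Finset.mem_univ e),
    ← Finset.add_sum_erase (a := e) _ (fun i => Function.update x e t i * y i) (Finset.mem_univ e),
    Function.update_self, Function.update_self]
  have h : ∑ i ∈ Finset.univ.erase e, Function.update x e t' i * y i =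
      ∑ i ∈ Finset.univ.erase e, Function.update x e t i * y i :=
    Finset.sum_congr rfl fun i hi => by
      rw [Function.update_of_ne (Finset.ne_of_mem_erase hi),
        Function.update_of_ne (Finset.ne_of_mem_erase hi)]
  rw [h]
  ring

lemma isClosed_exists_mem_of_isCompact {X Y : Type*} [TopologicalSpace X] [TopologicalSpace Y]
    {K : Set X} (hK : IsCompact K) {Z : Set (X × Y)} (hZ : IsClosed Z) :
    IsClosed {y | ∃ x ∈ K, (x, y) ∈ Z} := by
  have : CompactSpace K := isCompact_iff_compactSpace.1 hK
  have h := isClosedMap_snd_of_compactSpace (X := K) (Y := Y) _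
    (hZ.preimage (f := fun p : K × Y => ((p.1 : X), p.2)) (by fun_prop))
  convert h using 1
  ext y
  simp

variable {S : Set (E → ℝ)} {e : E} {b r : ℝ}

lemma measurableSet_nearTie (hS : IsCompact S) : MeasurableSet (nearTie S e b r) := by
  refine MeasurableSet.inter (IsClosed.measurableSet ?_) (IsOpen.measurableSet ?_)
  · have hZ : IsClosed {p : (E → ℝ) × (E → ℝ) | p.1 e = b ∧
        ∀ g ∈ S, ∑ i, p.2 i * p.1 i ≤ ∑ i, p.2 i * g i} := by
      have : {p : (E → ℝ) × (E → ℝ) | p.1 e = b ∧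
          ∀ g ∈ S, ∑ i, p.2 i * p.1 i ≤ ∑ i, p.2 i * g i} = {p | p.1 e = b} ∩
            ⋂ g ∈ S, {p | ∑ i, p.2 i * p.1 i ≤ ∑ i, p.2 i * g i} := by
        ext p
        simp
      rw [this]
      exact (isClosed_eq (by fun_prop) (by fun_prop)).inter
        (isClosed_biInter fun g _ => isClosed_le (by fun_prop) (by fun_prop))
    exact isClosed_exists_mem_of_isCompact hS hZ
  -- For fixed `f` the complement is the projection of a closed set along the compact `S`, hence
  -- closed; the union over `f` is open.
  · have : {c : E → ℝ | ∃ f ∈ S, f e ≠ b ∧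
        ∀ g ∈ S, g e = b → ∑ i, c i * f i < ∑ i, c i * g i + r * |f e - b|} =
        ⋃ f ∈ S ∩ {f | f e ≠ b}, {c : E → ℝ | ∃ g ∈ S, (g, c) ∈
          {p : (E → ℝ) × (E → ℝ) | p.1 e = b ∧
            ∑ i, p.2 i * p.1 i + r * |f e - b| ≤ ∑ i, p.2 i * f i}}ᶜ := by
      ext c
      simp [and_assoc]
    rw [this]
    refine isOpen_biUnion fun f _ => (isClosed_exists_mem_of_isCompact hS ?_).isOpen_compl
    have hZ : IsClosed ({p : (E → ℝ) × (E → ℝ) | p.1 e = b} ∩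
        {p | ∑ i, p.2 i * p.1 i + r * |f e - b| ≤ ∑ i, p.2 i * f i}) :=
      (isClosed_eq (by fun_prop) (by fun_prop)).inter (isClosed_le (by fun_prop) (by fun_prop))
    exact hZ

open scoped Classical in
-- Let `g` be the minimizer at `t` and `f` the near-optimal competitor at `t'`. Passing from `t` to
-- `t'` changes their costs by (t' - t) b and (t' - t) f(e), and `g` beats `f` at `t`.
lemma exists_of_update_mem_nearTie {x : E → ℝ} {t t' : ℝ}
    (ht : Function.update x e t ∈ nearTie S e b r)
    (ht' : Function.update x e t' ∈ nearTie S e b r) :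
    ∃ f ∈ S, f e ≠ b ∧ (t' - t) * (f e - b) < r * |f e - b| := by
  obtain ⟨⟨g, hg, hgb, hopt⟩, -⟩ := ht
  obtain ⟨-, f, hf, hfb, hlt⟩ := ht'
  refine ⟨f, hf, hfb, ?_⟩
  have h1 := hopt f hf
  have h2 := hlt g hg hgb
  rw [sum_update_mul x f e t t', sum_update_mul x g e t t', hgb] at h2
  linarith

open scoped Classical in
-- As `b` is a bound for the coordinate, f(e) - b has a known sign and cancels; exchanging `t` and
-- `t'` gives the other inequality.
lemma nearTie_fiber_dist (hb : (∀ f ∈ S, b ≤ f e) ∨ (∀ f ∈ S, f e ≤ b)) {x : E → ℝ} {t t' : ℝ}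
    (ht : Function.update x e t ∈ nearTie S e b r)
    (ht' : Function.update x e t' ∈ nearTie S e b r) : |t - t'| ≤ r := by
  obtain ⟨f, hf, hfb, h⟩ := exists_of_update_mem_nearTie ht ht'
  obtain ⟨f', hf', hfb', h'⟩ := exists_of_update_mem_nearTie ht' ht
  rw [abs_le]
  rcases hb with hb | hb
  · have h1 : 0 < f e - b := sub_pos.2 (lt_of_le_of_ne (hb f hf) hfb.symm)
    have h2 : 0 < f' e - b := sub_pos.2 (lt_of_le_of_ne (hb f' hf') hfb'.symm)
    rw [abs_of_pos h1] at h
    rw [abs_of_pos h2] at h'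
    have h3 := lt_of_mul_lt_mul_right h h1.le
    have h4 := lt_of_mul_lt_mul_right h' h2.le
    constructor <;> linarith
  · have h1 : 0 < b - f e := sub_pos.2 (lt_of_le_of_ne (hb f hf) hfb)
    have h2 : 0 < b - f' e := sub_pos.2 (lt_of_le_of_ne (hb f' hf') hfb')
    rw [abs_sub_comm, abs_of_pos h1] at h
    rw [abs_sub_comm, abs_of_pos h2] at h'
    have h3 : t - t' < r := lt_of_mul_lt_mul_right (by linarith) h1.le
    have h4 : t' - t < r := lt_of_mul_lt_mul_right (by linarith) h2.le
    constructor <;> linarith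

lemma pi_measure_nearTie_le {φ : ℝ}
    (hν : ∀ e, ν e ≤ ENNReal.ofReal φ • volume.restrict (Set.Icc (0 : ℝ) 1))
    (hS : IsCompact S) (hb : (∀ f ∈ S, b ≤ f e) ∨ (∀ f ∈ S, f e ≤ b)) :
    Measure.pi ν (nearTie S e b r) ≤ ENNReal.ofReal φ * ENNReal.ofReal r :=
  pi_measure_le_of_fiber_dist hν (measurableSet_nearTie hS) e r
    fun _ _ _ ht ht' => nearTie_fiber_dist hb ht ht'

lemma pi_measure_hyperplane {φ : ℝ}
    (hν : ∀ e, ν e ≤ ENNReal.ofReal φ • volume.restrict (Set.Icc (0 : ℝ) 1))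
    {y : E → ℝ} (hy : ∃ e, y e ≠ 0) : Measure.pi ν {c | ∑ e, c e * y e = 0} = 0 := by
  classical
  obtain ⟨e, he⟩ := hy
  refine le_antisymm ?_ zero_le
  have hm : MeasurableSet {c : E → ℝ | ∑ e, c e * y e = 0} :=
    (isClosed_eq (by fun_prop) (by fun_prop)).measurableSet
  refine (pi_measure_le_of_fiber_dist hν hm e 0 fun x t t' ht ht' => ?_).trans (by simp)
  simp only [Set.mem_ofPred_eq] at ht ht'
  rw [sum_update_mul x y e t' t, ht', zero_add] at ht
  rw [(mul_eq_zero.1 ht).resolve_right he, abs_zero]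

lemma measure_le_withDensity {φ : ℝ} {μ : Measure ℝ} {g : ℝ → ℝ}
    (hg : ∀ x ∈ Set.Icc (0 : ℝ) 1, 0 ≤ g x ∧ g x ≤ φ)
    (hμ : μ = (volume.restrict (Set.Icc (0 : ℝ) 1)).withDensity fun x => ENNReal.ofReal (g x)) :
    μ ≤ ENNReal.ofReal φ • volume.restrict (Set.Icc (0 : ℝ) 1) := by
  rw [hμ, ← withDensity_const]
  refine withDensity_mono ?_
  filter_upwards [ae_restrict_mem measurableSet_Icc] with x hx
  exact ENNReal.ofReal_le_ofReal (hg x hx).2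

end Fiber

/-! ### Measurability and the expected number of iterations. -/

namespace FlowNetwork

variable {N : FlowNetwork V E}

lemma card_edges_le [Fintype V] [Fintype E] (N : FlowNetwork V E) :
    Fintype.card E ≤ Fintype.card V ^ 2 := by
  have h := Fintype.card_le_of_injective (fun e => (N.tail e, N.head e)) fun e e' h =>
    N.simple e e' (Prod.ext_iff.1 h).1 (Prod.ext_iff.1 h).2
  rwa [Fintype.card_prod, ← sq] at h

lemma two_le_card_nodes [Fintype V] (N : FlowNetwork V E) (e : E) : 2 ≤ Fintype.card V :=
  Fintype.one_lt_card_iff.2 ⟨_, _, N.tail_ne_head e⟩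

/-- All comparisons of costs that the algorithm performs. -/
def costPattern (c : E → ℝ) :
    (Finset (E ⊕ E) → Finset (E ⊕ E) → Prop) × (Finset (E ⊕ E) → Prop) :=
  (fun C D => meanCost c C ≤ meanCost c D, fun C => ∑ a ∈ C, arcCost c a < 0)

lemma HasRun.congr [Fintype E] {c d : E → ℝ} (h : costPattern c = costPattern d) {k : ℕ}
    (hk : N.HasRun c k) : N.HasRun d k := by
  obtain ⟨h1, h2⟩ := Prod.ext_iff.1 h
  obtain ⟨f, h0, hstep⟩ := hk
  refine ⟨f, h0, fun i hi => ?_⟩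
  obtain ⟨⟨D, hD, hneg⟩, C, δ, hC, hδ⟩ := hstep i hi
  refine ⟨⟨D, hD, (congrFun h2 D).mp hneg⟩, C, δ, ⟨hC.1, fun C' hC' => ?_⟩, hδ⟩
  exact (congrFun (congrFun h1 C) C').mp (hC.2 C' hC')

lemma continuous_sum_arcCost (C : Finset (E ⊕ E)) :
    Continuous fun c : E → ℝ => ∑ a ∈ C, arcCost c a := by
  refine continuous_finsetSum _ fun a _ => ?_
  rcases a with e | e <;> simp only [arcCost, Sum.elim_inl, Sum.elim_inr] <;> fun_prop

lemma measurable_costPattern [Fintype E] :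
    Measurable (costPattern : (E → ℝ) → _) := by
  refine Measurable.prodMk (measurable_pi_lambda _ fun C => measurable_pi_lambda _ fun D => ?_)
    (measurable_pi_lambda _ fun C => ?_)
  · refine measurableSet_setOfPred.1 (isClosed_le ?_ ?_).measurableSet <;>
      exact (continuous_sum_arcCost _).div_const _
  · exact measurableSet_setOfPred.1 (isOpen_lt (continuous_sum_arcCost _)
      continuous_const).measurableSet

/-- Costs influence runs only through `costPattern`, which takes values in a finite type. -/
lemma measurableSet_hasRun [Fintype E] (N : FlowNetwork V E) (k : ℕ) :
    MeasurableSet {c | N.HasRun c k} := by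
  have h : {c | N.HasRun c k} = costPattern ⁻¹' (costPattern '' {c | N.HasRun c k}) := by
    refine (Set.subset_preimage_image _ _).antisymm ?_
    rintro c ⟨d, hd, hdc⟩
    exact HasRun.congr hdc hd
  rw [h]
  exact measurable_costPattern (Set.toFinite _).measurableSet

lemma measurable_iterations [Fintype E] (N : FlowNetwork V E) : Measurable N.iterations := by
  classical
  refine Measurable.iSup fun k => ?_
  simp only [iSup_eq_if]
  exact Measurable.ite (N.measurableSet_hasRun k) measurable_const measurable_const

lemma pi_measure_hasRun_le [Fintype V] [Fintype E] {ν : E → Measure ℝ}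
    [∀ e, IsProbabilityMeasure (ν e)] {φ : ℝ} (hφ : 0 ≤ φ)
    (hν : ∀ e, ν e ≤ ENNReal.ofReal φ • volume.restrict (Set.Icc (0 : ℝ) 1)) [Nonempty V] (L : ℕ) :
    Measure.pi ν {c | N.HasRun c (Fintype.card E * (Fintype.card V * L) + 1)} ≤
      ENNReal.ofReal (4 * (Fintype.card E) * (Fintype.card V) * φ * (1 / 2) ^ L) := by
  classical
  set r : ℝ := 2 * Fintype.card V * (1 / 2) ^ L with hr
  let S := {f | N.IsFlow f}
  have hS : IsCompact S := N.isCompact_isFlow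
  have hsub : {c | N.HasRun c (Fintype.card E * (Fintype.card V * L) + 1)} ≤ᵐ[Measure.pi ν]
      ((⋃ D ∈ {D : Finset (E ⊕ E) | ∃ e, cycleVec D e ≠ 0},
          {c : E → ℝ | ∑ e, c e * cycleVec D e = 0}) ∪
        ⋃ e, (nearTie S e 0 r ∪ nearTie S e (N.cap e) r) : Set (E → ℝ)) := by
    filter_upwards [ae_mem_Icc hν] with c hc hrun
    rcases HasRun.exists_zero_cycle_or_nearTie hc hrun with ⟨D, hD, h⟩ | ⟨e, h⟩
    · exact Or.inl (Set.mem_biUnion hD h)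
    · exact Or.inr (Set.mem_iUnion.2 ⟨e, h⟩)
  refine (measure_mono_ae hsub).trans ((measure_union_le _ _).trans ?_)
  have h0 : Measure.pi ν (⋃ D ∈ {D : Finset (E ⊕ E) | ∃ e, cycleVec D e ≠ 0},
      {c : E → ℝ | ∑ e, c e * cycleVec D e = 0}) = 0 :=
    (measure_biUnion_null_iff (Set.to_countable _)).2 fun D hD => pi_measure_hyperplane hν hD
  have hle : ∀ e, Measure.pi ν (nearTie S e 0 r ∪ nearTie S e (N.cap e) r) ≤
      ENNReal.ofReal (2 * (φ * r)) := fun e => by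
    refine (measure_union_le _ _).trans ((add_le_add
      (pi_measure_nearTie_le hν hS (Or.inl fun f hf => (hf.1 e).1))
      (pi_measure_nearTie_le hν hS (Or.inr fun f hf => (hf.1 e).2))).trans ?_)
    rw [← ENNReal.ofReal_mul hφ, ← ENNReal.ofReal_add (by positivity) (by positivity), two_mul]
  rw [h0, zero_add]
  calc Measure.pi ν (⋃ e, (nearTie S e 0 r ∪ nearTie S e (N.cap e) r))
      ≤ ∑ e, Measure.pi ν (nearTie S e 0 r ∪ nearTie S e (N.cap e) r) :=
        measure_iUnion_fintype_le _ _
    _ ≤ ∑ _e : E, ENNReal.ofReal (2 * (φ * r)) := Finset.sum_le_sum fun e _ => hle e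
    _ = _ := by
        rw [Finset.sum_const, Finset.card_univ, nsmul_eq_mul, ← ENNReal.ofReal_natCast,
          ← ENNReal.ofReal_mul (by positivity), hr]
        congr 1
        ring

/-- A run of length k counts every L with M L < k, and there are ⌈k / M⌉ of these. -/
lemma iterations_le_tsum [Fintype E] (c : E → ℝ) {M : ℕ} (hM : 0 < M) :
    N.iterations c ≤
      M * ∑' L : ℕ, {c | N.HasRun c (M * L + 1)}.indicator (1 : (E → ℝ) → ℝ≥0∞) c := by
  refine iSup₂_le fun k hk => ?_
  have h1 : (k : ℝ≥0∞) ≤ M * ((k + M - 1) / M : ℕ) := by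
    have := Nat.div_add_mod (k + M - 1) M
    have := Nat.mod_lt (k + M - 1) hM
    exact_mod_cast (by omega : k ≤ M * ((k + M - 1) / M))
  refine h1.trans ?_
  gcongr
  calc (((k + M - 1) / M : ℕ) : ℝ≥0∞)
      = ∑ L ∈ Finset.range ((k + M - 1) / M), (1 : ℝ≥0∞) := by simp
    _ = ∑ L ∈ Finset.range ((k + M - 1) / M),
          {c | N.HasRun c (M * L + 1)}.indicator (1 : (E → ℝ) → ℝ≥0∞) c := by
        refine Finset.sum_congr rfl fun L hL => ?_
        rw [Set.indicator_of_mem]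
        · rfl
        · refine HasRun.mono hk ?_
          have hL := Finset.mem_range.1 hL
          have h2 : M * (L + 1) ≤ k + M - 1 :=
            (Nat.mul_le_mul_left M hL).trans (Nat.mul_div_le _ _)
          rw [mul_add] at h2
          omega
    _ ≤ _ := ENNReal.sum_le_tsum _

end FlowNetwork

/-- The first ⌈log₂ q⌉ terms are bounded by 1, the others by a geometric series with sum 2; rounding
up costs 1 more. -/
lemma tsum_le_logb {a : ℕ → ℝ≥0∞} {q : ℝ} (hq : 1 ≤ q) (h1 : ∀ L, a L ≤ 1)
    (h2 : ∀ L, a L ≤ ENNReal.ofReal (q * (1 / 2) ^ L)) :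
    ∑' L, a L ≤ ENNReal.ofReal (Real.logb 2 q + 3) := by
  have hlog : 0 ≤ Real.logb 2 q := Real.logb_nonneg one_lt_two hq
  obtain ⟨L₀, h, hceil⟩ : ∃ L₀ : ℕ, Real.logb 2 q ≤ L₀ ∧ (L₀ : ℝ) < Real.logb 2 q + 1 :=
    ⟨_, Nat.le_ceil _, Nat.ceil_lt_add_one hlog⟩
  have hL₀ : q * (1 / 2) ^ L₀ ≤ 1 := by
    rw [Real.logb_le_iff_le_rpow one_lt_two (by linarith), Real.rpow_natCast] at h
    rw [one_div, inv_pow, ← div_eq_mul_inv]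
    exact div_le_one_of_le₀ h (by positivity)
  rw [← Summable.sum_add_tsum_nat_add' (f := a) (k := L₀) ENNReal.summable]
  have hA : ∑ L ∈ Finset.range L₀, a L ≤ ENNReal.ofReal L₀ := by
    refine (Finset.sum_le_sum fun L _ => h1 L).trans ?_
    simp
  have hB : ∑' L, a (L + L₀) ≤ ENNReal.ofReal 2 := by
    have h2' : ENNReal.ofReal 2 = ∑' L : ℕ, ENNReal.ofReal ((1 / 2) ^ L) := by
      rw [← ENNReal.ofReal_tsum_of_nonneg (fun n => by positivity) summable_geometric_two,
        tsum_geometric_two]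
    rw [h2']
    refine ENNReal.tsum_le_tsum fun L => (h2 _).trans (ENNReal.ofReal_le_ofReal ?_)
    rw [pow_add, mul_comm ((1 / 2 : ℝ) ^ L), ← mul_assoc]
    exact mul_le_of_le_one_left (by positivity) hL₀
  refine (add_le_add hA hB).trans ?_
  rw [← ENNReal.ofReal_add (by positivity) (by positivity)]
  refine ENNReal.ofReal_le_ofReal ?_
  linarith

/-- The bound for costs whose laws have densities on `[0, 1]` bounded by `φ`. -/
theorem lintegral_iterations_le [Fintype V] [Fintype E] [Nonempty E] (N : FlowNetwork V E)
    {ν : E → Measure ℝ} [∀ e, IsProbabilityMeasure (ν e)] {φ : ℝ}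
    (hν : ∀ e, ν e ≤ ENNReal.ofReal φ • volume.restrict (Set.Icc (0 : ℝ) 1)) :
    ∫⁻ c, N.iterations c ∂Measure.pi ν ≤
      ENNReal.ofReal (9 * (Fintype.card E) * (Fintype.card V) *
        Real.logb 2 (Fintype.card V) * max 1 (Real.logb 2 φ)) := by
  obtain ⟨e₀⟩ := ‹Nonempty E›
  have : Nonempty V := ⟨N.tail e₀⟩
  have : Nonempty E := ⟨e₀⟩
  have hφ := one_le_of_le_smul (hν e₀)
  have hn2 : (2 : ℝ) ≤ Fintype.card V := by exact_mod_cast N.two_le_card_nodes e₀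
  have hmn : (Fintype.card E : ℝ) ≤ (Fintype.card V : ℝ) ^ 2 := by exact_mod_cast N.card_edges_le
  set m : ℝ := (Fintype.card E : ℝ) with hm
  set n : ℝ := (Fintype.card V : ℝ) with hn
  have hm0 : 0 ≤ m := by positivity
  have hq : 1 ≤ 4 * n ^ 3 * φ := by
    have : 1 ≤ n ^ 3 := one_le_pow₀ (by linarith)
    nlinarith
  have hM : 0 < Fintype.card E * Fintype.card V := Nat.mul_pos Fintype.card_pos Fintype.card_pos
  have hprob : ∀ L : ℕ, Measure.pi ν {c | N.HasRun c (Fintype.card E * Fintype.card V * L + 1)} ≤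
      ENNReal.ofReal (4 * n ^ 3 * φ * (1 / 2) ^ L) := fun L => by
    rw [mul_assoc (Fintype.card E)]
    refine (FlowNetwork.pi_measure_hasRun_le (by linarith) hν L).trans
      (ENNReal.ofReal_le_ofReal ?_)
    rw [← hm, ← hn]
    -- Here m ≤ n² removes m from the later logarithm.
    have : 4 * m * n ≤ 4 * n ^ 3 := by nlinarith
    gcongr
  have hlog : Real.logb 2 (4 * n ^ 3 * φ) = 2 + 3 * Real.logb 2 n + Real.logb 2 φ := by
    rw [Real.logb_mul (by positivity) (by positivity), Real.logb_mul (by positivity) (by positivity),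
      Real.logb_pow, show (4 : ℝ) = 2 ^ 2 by norm_num, Real.logb_pow,
      Real.logb_self_eq_one one_lt_two]
    norm_num
  calc ∫⁻ c, N.iterations c ∂Measure.pi ν
      ≤ ∫⁻ c, (Fintype.card E * Fintype.card V : ℕ) * ∑' L : ℕ,
          {c | N.HasRun c (Fintype.card E * Fintype.card V * L + 1)}.indicator
            (1 : (E → ℝ) → ℝ≥0∞) c ∂Measure.pi ν :=
        lintegral_mono fun c => FlowNetwork.iterations_le_tsum c hM
    _ = (Fintype.card E * Fintype.card V : ℕ) * ∑' L : ℕ,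
          Measure.pi ν {c | N.HasRun c (Fintype.card E * Fintype.card V * L + 1)} := by
        rw [lintegral_const_mul' _ _ (ENNReal.natCast_ne_top _), lintegral_tsum fun L =>
          (measurable_one.indicator (N.measurableSet_hasRun _)).aemeasurable]
        simp_rw [lintegral_indicator_one (N.measurableSet_hasRun _)]
    _ ≤ (Fintype.card E * Fintype.card V : ℕ) *
          ENNReal.ofReal (Real.logb 2 (4 * n ^ 3 * φ) + 3) := by
        gcongr
        exact tsum_le_logb hq (fun L => prob_le_one) hprob
    _ ≤ _ := by
        rw [← ENNReal.ofReal_natCast, ← ENNReal.ofReal_mul (by positivity), hlog, Nat.cast_mul,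
          ← hm, ← hn]
        refine ENNReal.ofReal_le_ofReal ?_
        have hx : 1 ≤ Real.logb 2 n := by
          rw [Real.le_logb_iff_rpow_le one_lt_two (by linarith), Real.rpow_one]
          exact hn2
        have hy := le_max_left 1 (Real.logb 2 φ)
        have hz := le_max_right 1 (Real.logb 2 φ)
        set x := Real.logb 2 n
        set y := max 1 (Real.logb 2 φ)
        -- Since x, y ≥ 1, the coefficients add up to 5 + 3 + 1 = 9.
        have hxy : 2 + 3 * x + Real.logb 2 φ + 3 ≤ 9 * x * y := by nlinarith
        calc m * n * (2 + 3 * x + Real.logb 2 φ + 3) ≤ m * n * (9 * x * y) := by gcongr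
          _ = 9 * m * n * x * y := by ring

end MinCostFlow

theorem mainTheorem1 :
    ∃ C : ℝ, 0 < C ∧
      ∀ (V : Type*) (E : Type*) [Fintype V] [Fintype E] (N : MinCostFlow.FlowNetwork V E)
        (Ω : Type*) [MeasurableSpace Ω] (P : MeasureTheory.Measure Ω)
        [MeasureTheory.IsProbabilityMeasure P] (φ : ℝ) (c : E → Ω → ℝ),
        MinCostFlow.IsSmoothedCost P φ c →
          Measurable (fun ω => N.iterations (fun e => c e ω)) ∧
          ∫⁻ ω, N.iterations (fun e => c e ω) ∂P ≤
            ENNReal.ofReal (C * (Fintype.card E : ℝ) * (Fintype.card V : ℝ) ^ 2 *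
              Real.logb 2 (Fintype.card V : ℝ) * max 1 (Real.logb 2 φ)) := by
  refine ⟨9, by norm_num, ?_⟩
  intro V E _ _ N Ω _ P _ φ c ⟨hc, hind, g, hg⟩
  have hmeas : Measurable fun ω e => c e ω := measurable_pi_lambda _ hc
  refine ⟨N.measurable_iterations.comp hmeas, ?_⟩
  -- Without edges both sides vanish; an edge forces n ≥ 2, so that log₂ n ≥ 1.
  rcases isEmpty_or_nonempty E with hE | hE
  · simp [MinCostFlow.FlowNetwork.iterations_eq_zero_of_isEmpty]
  have hprob : ∀ e, MeasureTheory.IsProbabilityMeasure (P.map (c e)) := fun e =>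
    MeasureTheory.Measure.isProbabilityMeasure_map (hc e).aemeasurable
  have hlaw := (ProbabilityTheory.iIndepFun_iff_map_fun_eq_pi_map
    fun e => (hc e).aemeasurable).1 hind
  rw [← MeasureTheory.lintegral_map (f := N.iterations) N.measurable_iterations hmeas, hlaw]
  refine (MinCostFlow.lintegral_iterations_le N (φ := φ) fun e =>
    MinCostFlow.measure_le_withDensity (hg e).2.1 (hg e).2.2).trans
      (ENNReal.ofReal_le_ofReal ?_)
  obtain ⟨e⟩ := hE
  have hn : (1 : ℝ) ≤ Fintype.card V := by
    exact_mod_cast one_le_two.trans (N.two_le_card_nodes e)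
  have hlog : 0 ≤ Real.logb 2 (Fintype.card V) := Real.logb_nonneg one_lt_two hn
  have hsq : (Fintype.card V : ℝ) ≤ (Fintype.card V : ℝ) ^ 2 := le_self_pow₀ hn two_ne_zero
  gcongr
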